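/- Let $\eta,\delta,\rho,T,d>0$, $\theta\in(0,1]$ and $x_a<x_b$. *The a-spatial problem.* For $p_0>0$, minimize over pairs $(p,u)$ $$\int_0^T\frac{p_t^2+u_t^2}{2}e^{-\rho t}\,dt+\frac{1-\theta}{\theta}\,\frac{p_T^2}{2}e^{-\rho T}\quad\text{subject to}\quad \dot p_t=(\eta-\delta)p_t-\eta u_t \ \text{ on } (0,T),\quad p_{t=0}=p_0,$$ where $u$ and $p$ are continuous on $[0,T]$. With $\xi=\sqrt{[2(\delta-\eta)+\rho]^2+4\eta^2}$ put, for $t\in[0,T]$, $$\tau^*_t=\frac{\eta\left((1-\theta)\xi-\{(1-\theta)[2(\delta-\eta)+\rho]-2\theta\}\tanh\left[\tfrac12\xi(T-t)\right]\right)}{\theta\xi+\{\theta[2(\delta-\eta)+\rho]+2\eta^2(1-\theta)\}\tanh\left[\tfrac12\xi(T-t)\right]}.$$ *The spatial problem.* Let $p_0:[x_a,x_b]\to(0,\infty)$ be continuous. Minimize over pairs $(u_{x,t},p_{x,t})$ $$\mathcal C=\int_0^T\!\!\int_{x_a}^{x_b}\frac{p_{x,t}^2+u_{x,t}^2}{2}e^{-\rho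 t}\,dx\,dt+\frac{1-\theta}{\theta}\int_{x_a}^{x_b}\frac{p_{x,T}^2}{2}e^{-\rho T}\,dx$$ subject to $$\frac{\partial p_{x,t}}{\partial t}=d\,\frac{\partial^2p_{x,t}}{\partial x^2}+(\eta-\delta)p_{x,t}-\eta u_{x,t}\ \text{ on } (x_a,x_b)\times(0,T),\qquad p_{x,0}=p_0(x),$$ $$\frac{\partial u_{x,t}}{\partial x}=\frac{\partial p_{x,t}}{\partial x}=0\ \text{ for } x\in\{x_a,x_b\},\ t\in(0,T].$$ Here $u$ and $p$ are continuous on $[x_a,x_b]\times[0,T]$, and $\partial p/\partial x$, $\partial^2p/\partial x^2$, $\partial p/\partial t$ exist and are continuous on $[x_a,x_b]\times(0,T)$ (one-sided space derivatives at $x_a,x_b$). A pair satisfying these constraints is called admissible. A *local pair* is a pair $(\overline u,\overline p)$ such that $\overline u_{x,t}=\tau^*_t\,\overline p_{x,t}$ on $[x_a,x_b]\times[0,T]$ and $\overline p$ is a classical solution, in the above sense, of the above equation with $u=\overline u$, the initial condition $\overline p_{x,0}=p_0(x)$ and the Neumann conditions $\partial\overline p_{x,t}/\partial x=0$ at $x\in\{x_a,x_b\}$,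 $t\in(0,T]$. **Proposition.** $\tau^*$ is the optimal tax of the a-spatial problem: for every initial level $p_0>0$ that problem has an optimal pair, and every optimal pair satisfies $p_t>0$ and $u_t=\tau^*_tp_t$ on $[0,T]$. If the initial distribution $p_0(x)$ of the spatial problem is not constant on $[x_a,x_b]$, then every local pair $(\overline u,\overline p)$ is admissible but is not an optimal solution of the spatial problem: some admissible pair has strictly smaller cost $\mathcal C$. -/

import Mathlib

open Set

/-! ### The a-spatial pollution control problem -/

/-- `(p, u)` is an admissible pair of the a-spatial problem with initial pollution `p₀`:
the control `u` is continuous on `[0, T]`, and `p` is continuous on `[0, T]` with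
`p' = (η - δ) p - η u` on `(0, T)` and `p 0 = p₀`. -/
structure AspatialAdmissible (η δ T p₀ : ℝ) (p u : ℝ → ℝ) : Prop where
  control_cont : ContinuousOn u (Icc 0 T)
  state_cont : ContinuousOn p (Icc 0 T)
  state_eq : ∀ t ∈ Ioo 0 T, HasDerivAt p ((η - δ) * p t - η * u t) t
  initial : p 0 = p₀

/-- The social cost in the a-spatial problem. -/
noncomputable def aspatialCost (ρ θ T : ℝ) (p u : ℝ → ℝ) : ℝ :=
  (∫ t in (0 : ℝ)..T, ((p t) ^ 2 + (u t) ^ 2) / 2 * Real.exp (-ρ * t))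
    + (1 - θ) / θ * ((p T) ^ 2 / 2) * Real.exp (-ρ * T)

/-- `(p, u)` is an optimal pair of the a-spatial problem with initial pollution `p₀`. -/
def AspatialOptimal (η δ ρ θ T p₀ : ℝ) (p u : ℝ → ℝ) : Prop :=
  AspatialAdmissible η δ T p₀ p u ∧
    ∀ q v : ℝ → ℝ, AspatialAdmissible η δ T p₀ q v →
      aspatialCost ρ θ T p u ≤ aspatialCost ρ θ T q v

/-- `τ` is the optimal tax rate of the a-spatial problem: for every initial pollution `p₀ > 0`
there is an optimal pair, and each optimal pair has `p > 0` and `u / p = τ` on `[0, T]`. -/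
def IsAspatialOptimalTax (η δ ρ θ T : ℝ) (τ : ℝ → ℝ) : Prop :=
  ∀ p₀ : ℝ, 0 < p₀ →
    (∃ p u : ℝ → ℝ, AspatialOptimal η δ ρ θ T p₀ p u) ∧
    ∀ p u : ℝ → ℝ, AspatialOptimal η δ ρ θ T p₀ p u →
      ∀ t ∈ Icc 0 T, 0 < p t ∧ u t = τ t * p t

/-- `ξ = √([2(δ - η) + ρ]² + 4η²)`. -/
noncomputable def xiConst (η δ ρ : ℝ) : ℝ :=
  Real.sqrt ((2 * (δ - η) + ρ) ^ 2 + 4 * η ^ 2)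

/-- The tax rate `τ*_t` of the a-spatial problem in closed form. -/
noncomputable def localTax (η δ ρ θ T t : ℝ) : ℝ :=
  η * ((1 - θ) * xiConst η δ ρ
      - ((1 - θ) * (2 * (δ - η) + ρ) - 2 * θ) * Real.tanh (xiConst η δ ρ * (T - t) / 2))
    / (θ * xiConst η δ ρ
      + (θ * (2 * (δ - η) + ρ) + 2 * η ^ 2 * (1 - θ)) * Real.tanh (xiConst η δ ρ * (T - t) / 2))

/-! ### The spatial pollution control problem on `[xa, xb]` -/

/-- Homogeneous Neumann conditions at `xa` and `xb` at all times in `(0, T]`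
(one-sided space derivatives). -/
def Neumann (xa xb T : ℝ) (f : ℝ → ℝ → ℝ) : Prop :=
  ∀ t ∈ Ioc 0 T,
    HasDerivWithinAt (fun x => f x t) 0 (Icc xa xb) xa ∧
    HasDerivWithinAt (fun x => f x t) 0 (Icc xa xb) xb

/-- `p` is the pollution path generated by the control `u` from the initial distribution `p₀`:
a classical solution of `∂p/∂t = d ∂²p/∂x² + (η - δ) p - η u` on `(xa, xb) × (0, T)` with Neumann
conditions and `p x 0 = p₀ x`. Here `p` is continuous on `[xa, xb] × [0, T]`, and its derivatives
`px = ∂p/∂x`, `pxx = ∂²p/∂x²`, `pt = ∂p/∂t` are continuous on `[xa, xb] × (0, T)`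
(no derivative is required to extend to `t = 0`, so that `p₀` may be any continuous function). -/
structure IsPollutionPath (d η δ xa xb T : ℝ) (p₀ : ℝ → ℝ) (p u : ℝ → ℝ → ℝ) : Prop where
  state_cont : ContinuousOn (fun z : ℝ × ℝ => p z.1 z.2) (Icc xa xb ×ˢ Icc 0 T)
  state_eq : ∃ px pxx pt : ℝ → ℝ → ℝ,
    ContinuousOn (fun z : ℝ × ℝ => px z.1 z.2) (Icc xa xb ×ˢ Ioo 0 T) ∧
    ContinuousOn (fun z : ℝ × ℝ => pxx z.1 z.2) (Icc xa xb ×ˢ Ioo 0 T) ∧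
    ContinuousOn (fun z : ℝ × ℝ => pt z.1 z.2) (Icc xa xb ×ˢ Ioo 0 T) ∧
    (∀ x ∈ Icc xa xb, ∀ t ∈ Ioo 0 T,
      HasDerivWithinAt (fun y => p y t) (px x t) (Icc xa xb) x ∧
      HasDerivWithinAt (fun y => px y t) (pxx x t) (Icc xa xb) x ∧
      HasDerivAt (fun s => p x s) (pt x t) t) ∧
    (∀ x ∈ Ioo xa xb, ∀ t ∈ Ioo 0 T,
      pt x t = d * pxx x t + (η - δ) * p x t - η * u x t)
  neumann : Neumann xa xb T p
  initial : ∀ x ∈ Icc xa xb, p x 0 = p₀ x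

/-- `(p, u)` is an admissible pair of the spatial problem: the control `u` is continuous on
`[xa, xb] × [0, T]` and satisfies the Neumann conditions, and `p` is the pollution path it
generates from `p₀`. -/
structure SpatialAdmissible (d η δ xa xb T : ℝ) (p₀ : ℝ → ℝ) (p u : ℝ → ℝ → ℝ) : Prop where
  control_cont : ContinuousOn (fun z : ℝ × ℝ => u z.1 z.2) (Icc xa xb ×ˢ Icc 0 T)
  control_neumann : Neumann xa xb T u
  state : IsPollutionPath d η δ xa xb T p₀ p u

/-- The social cost in the spatial problem. -/
noncomputable def spatialCost (ρ θ xa xb T : ℝ) (p u : ℝ → ℝ → ℝ) : ℝ :=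
  (∫ t in (0 : ℝ)..T, ∫ x in xa..xb,
      ((p x t) ^ 2 + (u x t) ^ 2) / 2 * Real.exp (-ρ * t))
    + (1 - θ) / θ * ∫ x in xa..xb, (p x T) ^ 2 / 2 * Real.exp (-ρ * T)

/-- `(p, u)` is an optimal pair of the spatial problem. -/
def SpatialOptimal (d η δ ρ θ xa xb T : ℝ) (p₀ : ℝ → ℝ) (p u : ℝ → ℝ → ℝ) : Prop :=
  SpatialAdmissible d η δ xa xb T p₀ p u ∧
    ∀ q v : ℝ → ℝ → ℝ, SpatialAdmissible d η δ xa xb T p₀ q v →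
      spatialCost ρ θ xa xb T p u ≤ spatialCost ρ θ xa xb T q v

/-- `(p, u)` is the local pair for the spatially homogeneous tax `τ`: the control is `u = τ p`,
and `p` is the pollution path, with diffusion, that it generates from `p₀`. -/
structure IsLocalPair (d η δ xa xb T : ℝ) (τ : ℝ → ℝ) (p₀ : ℝ → ℝ) (p u : ℝ → ℝ → ℝ) :
    Prop where
  control_eq : ∀ x ∈ Icc xa xb, ∀ t ∈ Icc 0 T, u x t = τ t * p x t
  state : IsPollutionPath d η δ xa xb T p₀ p u

/-! Write `b = 2(δ - η) + ρ`. The tax is `η R`, where `R` solves `R' = η² R² + b R - 1` with `R(T) =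
(1 - θ)/θ`. Along an admissible a-spatial pair, differentiating `R p² e^{-ρt}/2` and completing the
square turns the cost into `R(0) p₀²/2 + ∫ (u - τ* p)² e^{-ρt}/2` (`aspatialCost_eq`). The minimum
is thus attained exactly when `u = τ* p`.

For the spatial problem, a nonconstant `p₀` has a nonzero Neumann cosine coefficient at some
frequency `ω ≠ 0` (`exists_integral_mul_cos_ne_zero`). A local pair is perturbed by the state `ε t
cos(ω(x - xa))`, with the control that keeps it admissible; the cost is then a quadratic polynomial
in `ε`. Its linear coefficient is `-2dω² ∫ R t e^{-ρt} c(t) dt`, with `c` the cosine coefficient of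
the local state (`IsLocalPair.firstVariation_eq`): `R` balances everything except diffusion. Since
`c` solves a scalar linear equation, it keeps the sign of `c(0) ≠ 0`. So the first variation is
nonzero, and a small `ε` of the right sign lowers the cost. -/

/-! ### The Riccati solution behind the tax -/

/-- The numerator of `localTax`, up to the factor `η`, multiplied by `cosh (ξ (T - t) / 2)`. -/
noncomputable def taxNum (η δ ρ θ T t : ℝ) : ℝ :=
  (1 - θ) * xiConst η δ ρ * Real.cosh (xiConst η δ ρ * (T - t) / 2)
    - ((1 - θ) * (2 * (δ - η) + ρ) - 2 * θ) * Real.sinh (xiConst η δ ρ * (T - t) / 2)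

/-- The denominator of `localTax` multiplied by `cosh (ξ (T - t) / 2)`. -/
noncomputable def taxDen (η δ ρ θ T t : ℝ) : ℝ :=
  θ * xiConst η δ ρ * Real.cosh (xiConst η δ ρ * (T - t) / 2)
    + (θ * (2 * (δ - η) + ρ) + 2 * η ^ 2 * (1 - θ)) * Real.sinh (xiConst η δ ρ * (T - t) / 2)

/-- The solution of the Riccati equation of the a-spatial problem. -/
noncomputable def riccati (η δ ρ θ T t : ℝ) : ℝ :=
  taxNum η δ ρ θ T t / taxDen η δ ρ θ T t

theorem xiConst_sq (η δ ρ : ℝ) :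
    xiConst η δ ρ ^ 2 = (2 * (δ - η) + ρ) ^ 2 + 4 * η ^ 2 :=
  Real.sq_sqrt (by positivity)

theorem abs_lt_xiConst {η : ℝ} (hη : 0 < η) (δ ρ : ℝ) :
    |2 * (δ - η) + ρ| < xiConst η δ ρ := by
  rw [← Real.sqrt_sq_eq_abs]
  exact Real.sqrt_lt_sqrt (sq_nonneg _) (by nlinarith [pow_pos hη 2])

theorem localTax_eq (η δ ρ θ T t : ℝ) :
    localTax η δ ρ θ T t = η * riccati η δ ρ θ T t := by
  have hc := (Real.cosh_pos (xiConst η δ ρ * (T - t) / 2)).ne'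
  rw [localTax, riccati, taxNum, taxDen, Real.tanh_eq_sinh_div_cosh, ← mul_div_assoc,
    ← mul_div_mul_right _ _ hc]
  field_simp

theorem hasDerivAt_xi_mul (ξ T t : ℝ) :
    HasDerivAt (fun s => ξ * (T - s) / 2) (-ξ / 2) t := by
  have h := (((hasDerivAt_id t).const_sub T).const_mul ξ).div_const 2
  refine h.congr_deriv ?_
  ring

/-- Numerator and denominator form a linear system that linearizes the Riccati equation for their
quotient; `ξ² = b² + 4η²` closes the system. -/
theorem hasDerivAt_taxDen (η δ ρ θ T t : ℝ) :
    HasDerivAt (taxDen η δ ρ θ T)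
      (-(η ^ 2 * taxNum η δ ρ θ T t + (2 * (δ - η) + ρ) / 2 * taxDen η δ ρ θ T t)) t := by
  have hl := hasDerivAt_xi_mul (xiConst η δ ρ) T t
  have h := (hl.cosh.const_mul (θ * xiConst η δ ρ)).add
    (hl.sinh.const_mul (θ * (2 * (δ - η) + ρ) + 2 * η ^ 2 * (1 - θ)))
  refine h.congr_deriv ?_
  rw [taxNum, taxDen]
  linear_combination
    -(θ / 2 * Real.sinh (xiConst η δ ρ * (T - t) / 2)) * xiConst_sq η δ ρ

theorem hasDerivAt_taxNum (η δ ρ θ T t : ℝ) :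
    HasDerivAt (taxNum η δ ρ θ T)
      ((2 * (δ - η) + ρ) / 2 * taxNum η δ ρ θ T t - taxDen η δ ρ θ T t) t := by
  have hl := hasDerivAt_xi_mul (xiConst η δ ρ) T t
  have h := (hl.cosh.const_mul ((1 - θ) * xiConst η δ ρ)).sub
    (hl.sinh.const_mul ((1 - θ) * (2 * (δ - η) + ρ) - 2 * θ))
  refine h.congr_deriv ?_
  rw [taxNum, taxDen]
  linear_combination
    -((1 - θ) / 2 * Real.sinh (xiConst η δ ρ * (T - t) / 2)) * xiConst_sq η δ ρ

/-- The expression equals `ξ (cosh s - sinh s) + (ξ + b) sinh s`, a positive term plus a nonnegative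
one. -/
theorem xi_cosh_add_sinh_pos {ξ b s : ℝ} (hb : |b| < ξ) (hs : 0 ≤ s) :
    0 < ξ * Real.cosh s + b * Real.sinh s := by
  have h1 := Real.sinh_nonneg_iff.2 hs
  have h2 := Real.sinh_lt_cosh s
  have h3 : 0 < ξ := (abs_nonneg b).trans_lt hb
  have h4 : -ξ < b := (abs_lt.1 hb).1
  nlinarith [mul_pos h3 (sub_pos.2 h2), mul_nonneg (sub_pos.2 h4).le h1]

section Positivity

variable {η θ : ℝ} (δ ρ : ℝ) {T t : ℝ}

theorem taxDen_pos (hη : 0 < η) (hθ : θ ∈ Ioc (0 : ℝ) 1) (ht : t ≤ T) :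
    0 < taxDen η δ ρ θ T t := by
  have hb := abs_lt_xiConst hη δ ρ
  have hξ : 0 < xiConst η δ ρ := (abs_nonneg _).trans_lt hb
  have hs : 0 ≤ xiConst η δ ρ * (T - t) / 2 := by
    have := sub_nonneg.2 ht
    positivity
  have h1 := mul_pos hθ.1 (xi_cosh_add_sinh_pos hb hs)
  have h2 : 0 ≤ 2 * η ^ 2 * (1 - θ) * Real.sinh (xiConst η δ ρ * (T - t) / 2) := by
    have := Real.sinh_nonneg_iff.2 hs
    have := sub_nonneg.2 hθ.2
    positivity
  rw [taxDen]
  linarith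

theorem taxNum_pos (hη : 0 < η) (hθ : θ ∈ Ioc (0 : ℝ) 1) (ht : t < T) :
    0 < taxNum η δ ρ θ T t := by
  have hb := abs_lt_xiConst hη δ ρ
  have hξ : 0 < xiConst η δ ρ := (abs_nonneg _).trans_lt hb
  have hs : 0 < xiConst η δ ρ * (T - t) / 2 := by
    have := sub_pos.2 ht
    positivity
  -- In the numerator `b` enters with a minus sign, so the bound is applied to `-b`. The case `t =
  -- T` is excluded because the numerator vanishes there when `θ = 1`.
  rw [← abs_neg] at hb
  have h1 := mul_nonneg (sub_nonneg.2 hθ.2) (xi_cosh_add_sinh_pos hb hs.le).le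
  have h2 := mul_pos hθ.1 (Real.sinh_pos_iff.2 hs)
  rw [taxNum]
  linarith

theorem riccati_pos (hη : 0 < η) (hθ : θ ∈ Ioc (0 : ℝ) 1) (ht : t < T) :
    0 < riccati η δ ρ θ T t :=
  div_pos (taxNum_pos δ ρ hη hθ ht) (taxDen_pos δ ρ hη hθ ht.le)

theorem hasDerivAt_riccati (hη : 0 < η) (hθ : θ ∈ Ioc (0 : ℝ) 1) (ht : t ≤ T) :
    HasDerivAt (riccati η δ ρ θ T)
      (η ^ 2 * riccati η δ ρ θ T t ^ 2 + (2 * (δ - η) + ρ) * riccati η δ ρ θ T t - 1) t := by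
  have hD := (taxDen_pos δ ρ hη hθ ht).ne'
  have h := (hasDerivAt_taxNum η δ ρ θ T t).div (hasDerivAt_taxDen η δ ρ θ T t) hD
  refine h.congr_deriv ?_
  rw [riccati]
  field_simp
  ring

theorem continuousOn_riccati (hη : 0 < η) (hθ : θ ∈ Ioc (0 : ℝ) 1) :
    ContinuousOn (riccati η δ ρ θ T) (Icc 0 T) := fun _ hs =>
  (hasDerivAt_riccati δ ρ hη hθ hs.2).continuousAt.continuousWithinAt

theorem riccati_terminal (hη : 0 < η) (θ T : ℝ) :
    riccati η δ ρ θ T T = (1 - θ) / θ := by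
  have hξ : xiConst η δ ρ ≠ 0 := ((abs_nonneg _).trans_lt (abs_lt_xiConst hη δ ρ)).ne'
  simp [riccati, taxNum, taxDen, mul_div_mul_right _ _ hξ]

/-- A positive solution of the closed-loop equation `p' = (η - δ - η τ - κ) p`. -/
noncomputable def closedLoop (η δ ρ θ T κ t : ℝ) : ℝ :=
  taxDen η δ ρ θ T t * Real.exp ((ρ / 2 - κ) * t)

theorem closedLoop_pos (κ : ℝ) (hη : 0 < η) (hθ : θ ∈ Ioc (0 : ℝ) 1) (ht : t ≤ T) :
    0 < closedLoop η δ ρ θ T κ t :=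
  mul_pos (taxDen_pos δ ρ hη hθ ht) (Real.exp_pos _)

/-- The logarithmic derivative of `taxDen` is `-η² R - b/2`, and the exponential factor adds `ρ/2 -
κ`. The value `κ = 0` serves the a-spatial state, `κ = dω²` a cosine mode under diffusion. -/
theorem hasDerivAt_closedLoop (κ : ℝ) (hη : 0 < η) (hθ : θ ∈ Ioc (0 : ℝ) 1) (ht : t ≤ T) :
    HasDerivAt (closedLoop η δ ρ θ T κ)
      ((η - δ - η * localTax η δ ρ θ T t - κ) * closedLoop η δ ρ θ T κ t) t := by
  have hD := (taxDen_pos δ ρ hη hθ ht).ne'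
  have h := (hasDerivAt_taxDen η δ ρ θ T t).mul
    (((hasDerivAt_id t).const_mul (ρ / 2 - κ)).exp)
  refine h.congr_deriv ?_
  simp only [localTax_eq, riccati, closedLoop, id]
  field_simp
  ring

end Positivity

/-- Two solutions of a scalar linear equation are proportional. -/
theorem eq_mul_of_linear_ode {f g α : ℝ → ℝ} {T : ℝ} (hf : ContinuousOn f (Icc 0 T))
    (hg : ContinuousOn g (Icc 0 T)) (hg0 : ∀ t ∈ Icc 0 T, g t ≠ 0)
    (hf' : ∀ t ∈ Ioo 0 T, HasDerivAt f (α t * f t) t)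
    (hg' : ∀ t ∈ Ioo 0 T, HasDerivAt g (α t * g t) t) {t : ℝ} (ht : t ∈ Icc 0 T) :
    f t = f 0 / g 0 * g t := by
  have hsub : Icc 0 t ⊆ Icc 0 T := Icc_subset_Icc_right ht.2
  have h := intervalIntegral.integral_eq_sub_of_hasDerivAt_of_le (f := fun s => f s / g s)
    (f' := fun _ => 0) ht.1 ((hf.mono hsub).div (hg.mono hsub) fun s hs => hg0 s (hsub hs))
    (fun s hs => by
      have hs' : s ∈ Ioo 0 T := ⟨hs.1, hs.2.trans_le ht.2⟩
      refine ((hf' s hs').div (hg' s hs') (hg0 s (Ioo_subset_Icc_self hs'))).congr_deriv ?_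
      ring)
    intervalIntegrable_const
  rw [intervalIntegral.integral_zero] at h
  have h0 := hg0 t ht
  rw [← sub_eq_zero.1 h.symm, div_mul_cancel₀ _ h0]

/-! ### The a-spatial problem -/

section Aspatial

variable {η δ ρ θ T p₀ : ℝ} {p u : ℝ → ℝ}

theorem AspatialAdmissible.continuousOn_gap (hη : 0 < η) (hθ : θ ∈ Ioc (0 : ℝ) 1)
    (h : AspatialAdmissible η δ T p₀ p u) :
    ContinuousOn (fun t => (u t - localTax η δ ρ θ T t * p t) ^ 2 / 2 * Real.exp (-ρ * t))
      (Icc 0 T) := by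
  have hR := continuousOn_riccati (T := T) δ ρ hη hθ
  have hp := h.state_cont
  have hu := h.control_cont
  simp only [localTax_eq]
  fun_prop

/-- Completion of the square: by the Riccati equation the derivative of `R p² e^{-ρt}/2` is the
squared gap minus the running cost, and `R(T)` matches the terminal weight. -/
theorem aspatialCost_eq (hη : 0 < η) (hθ : θ ∈ Ioc (0 : ℝ) 1) (hT : 0 < T)
    (h : AspatialAdmissible η δ T p₀ p u) :
    aspatialCost ρ θ T p u = riccati η δ ρ θ T 0 * p₀ ^ 2 / 2 +
      ∫ t in (0 : ℝ)..T, (u t - localTax η δ ρ θ T t * p t) ^ 2 / 2 * Real.exp (-ρ * t) := by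
  have hR := continuousOn_riccati (T := T) δ ρ hη hθ
  have hp := h.state_cont
  have hu := h.control_cont
  have hG := h.continuousOn_gap (ρ := ρ) hη hθ
  have hL : ContinuousOn (fun t => (p t ^ 2 + u t ^ 2) / 2 * Real.exp (-ρ * t)) (Icc 0 T) := by
    fun_prop
  have hGi : IntervalIntegrable _ MeasureTheory.volume 0 T :=
    hG.intervalIntegrable_of_Icc hT.le
  have hLi : IntervalIntegrable _ MeasureTheory.volume 0 T :=
    hL.intervalIntegrable_of_Icc hT.le
  have key := intervalIntegral.integral_eq_sub_of_hasDerivAt_of_le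
    (f := fun t => riccati η δ ρ θ T t * (p t) ^ 2 / 2 * Real.exp (-ρ * t)) hT.le
    (by fun_prop) (fun t ht => by
      have h1 := hasDerivAt_riccati δ ρ hη hθ ht.2.le
      have h2 := h.state_eq t ht
      have h3 := ((hasDerivAt_id t).const_mul (-ρ)).exp
      have h4 := ((h1.mul (h2.pow 2)).div_const 2).mul h3
      refine h4.congr_deriv (g' := (u t - localTax η δ ρ θ T t * p t) ^ 2 / 2 * Real.exp (-ρ * t)
        - (p t ^ 2 + u t ^ 2) / 2 * Real.exp (-ρ * t)) ?_
      simp [localTax_eq]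
      ring) (hGi.sub hLi)
  rw [intervalIntegral.integral_sub hGi hLi, riccati_terminal δ ρ hη, h.initial] at key
  simp only [mul_zero, Real.exp_zero, mul_one] at key
  rw [aspatialCost]
  linear_combination -key

theorem aspatialAdmissible_closedLoop (hη : 0 < η) (hθ : θ ∈ Ioc (0 : ℝ) 1) (hT : 0 < T)
    (p₀ : ℝ) :
    AspatialAdmissible η δ T p₀
      (fun t => p₀ / closedLoop η δ ρ θ T 0 0 * closedLoop η δ ρ θ T 0 t)
      (fun t => localTax η δ ρ θ T t *
        (p₀ / closedLoop η δ ρ θ T 0 0 * closedLoop η δ ρ θ T 0 t)) := by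
  have hE : ContinuousOn (closedLoop η δ ρ θ T 0) (Icc 0 T) := fun t ht =>
    (hasDerivAt_closedLoop δ ρ 0 hη hθ ht.2).continuousAt.continuousWithinAt
  have hR := continuousOn_riccati (T := T) δ ρ hη hθ
  refine ⟨by simp only [localTax_eq]; fun_prop, by fun_prop, fun t ht => ?_,
    div_mul_cancel₀ _ (closedLoop_pos δ ρ 0 hη hθ hT.le).ne'⟩
  refine ((hasDerivAt_closedLoop δ ρ 0 hη hθ ht.2.le).const_mul _).congr_deriv ?_
  ring

theorem isAspatialOptimalTax_localTax (hη : 0 < η) (hθ : θ ∈ Ioc (0 : ℝ) 1) (hT : 0 < T) :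
    IsAspatialOptimalTax η δ ρ θ T (localTax η δ ρ θ T) := by
  intro p₀ hp₀
  have hadm := aspatialAdmissible_closedLoop (δ := δ) (ρ := ρ) hη hθ hT p₀
  have hcost := aspatialCost_eq (ρ := ρ) hη hθ hT hadm
  simp only [sub_self, ne_eq, OfNat.ofNat_ne_zero, not_false_eq_true, zero_pow, zero_div, zero_mul,
    intervalIntegral.integral_zero, add_zero] at hcost
  have hnonneg : ∀ q v : ℝ → ℝ, ∀ t : ℝ,
      0 ≤ (v t - localTax η δ ρ θ T t * q t) ^ 2 / 2 * Real.exp (-ρ * t) := fun q v t => by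
    positivity
  refine ⟨⟨_, _, hadm, fun q v hqv => ?_⟩, fun p u hpu => ?_⟩
  · rw [hcost, aspatialCost_eq hη hθ hT hqv]
    exact le_add_of_nonneg_right
      (intervalIntegral.integral_nonneg hT.le fun t _ => hnonneg q v t)
  · have hle := hpu.2 _ _ hadm
    rw [hcost, aspatialCost_eq hη hθ hT hpu.1] at hle
    have hG := hpu.1.continuousOn_gap (ρ := ρ) hη hθ
    -- The gap is continuous and nonnegative, so one nonzero value anywhere on `[0, T]`, endpoints
    -- included, would make its integral positive.
    have hctrl : ∀ t ∈ Icc 0 T, u t = localTax η δ ρ θ T t * p t := by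
      intro t ht
      by_contra hne
      have hpos := intervalIntegral.integral_pos hT hG (fun s _ => hnonneg p u s)
        ⟨t, ht, by
          have := sub_ne_zero.2 hne
          positivity⟩
      linarith
    intro t ht
    refine ⟨?_, hctrl t ht⟩
    have hE : ContinuousOn (closedLoop η δ ρ θ T 0) (Icc 0 T) := fun t ht =>
      (hasDerivAt_closedLoop δ ρ 0 hη hθ ht.2).continuousAt.continuousWithinAt
    rw [eq_mul_of_linear_ode hpu.1.state_cont hE
      (fun s hs => (closedLoop_pos δ ρ 0 hη hθ hs.2).ne')
      (fun s hs => (hpu.1.state_eq s hs).congr_deriv (by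
        rw [hctrl s (Ioo_subset_Icc_self hs)]; ring))
      (fun s hs => hasDerivAt_closedLoop δ ρ 0 hη hθ hs.2.le) ht, hpu.1.initial]
    exact mul_pos (div_pos hp₀ (closedLoop_pos δ ρ 0 hη hθ hT.le))
      (closedLoop_pos δ ρ 0 hη hθ ht.2)

end Aspatial

/-! ### Cosine coefficients of a nonconstant function -/

section Cosine

variable {a b : ℝ} {f : ℝ → ℝ}

theorem integral_cos_mul_sub_eq_zero {ω : ℝ} (hω : ω ≠ 0) (hsin : Real.sin (ω * (b - a)) = 0) :
    ∫ x in a..b, Real.cos (ω * (x - a)) = 0 := by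
  have h : ∀ x, HasDerivAt (fun y => Real.sin (ω * (y - a)) / ω) (Real.cos (ω * (x - a))) x := by
    intro x
    refine ((((hasDerivAt_id x).sub_const a).const_mul ω).sin.div_const ω).congr_deriv ?_
    simp [hω]
  rw [intervalIntegral.integral_eq_sub_of_hasDerivAt (fun x _ => h x)
    ((by fun_prop : Continuous _).intervalIntegrable _ _)]
  simp [hsin]

/-- Each extra power of the cosine is absorbed by `2 cos φ cos nφ = cos (n+1)φ + cos (n-1)φ`;
integer `n` lets the index drop below zero. -/
theorem integral_mul_cos_pow_mul_cos_eq_zero (hab : a ≤ b) (hf : ContinuousOn f (Icc a b)) {ω : ℝ}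
    (h : ∀ n : ℤ, ∫ x in a..b, f x * Real.cos (n * (ω * (x - a))) = 0) (k : ℕ) (n : ℤ) :
    ∫ x in a..b, f x * (Real.cos (ω * (x - a)) ^ k * Real.cos (n * (ω * (x - a)))) = 0 := by
  induction k generalizing n with
  | zero => simpa using h n
  | succ k ih =>
    have hint : ∀ m : ℤ, IntervalIntegrable
        (fun x => f x * (Real.cos (ω * (x - a)) ^ k * Real.cos (m * (ω * (x - a)))))
        MeasureTheory.volume a b := fun m =>
      (by fun_prop : ContinuousOn _ (Icc a b)).intervalIntegrable_of_Icc hab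
    have hsum := intervalIntegral.integral_add (hint (n + 1)) (hint (n - 1))
    rw [ih, ih, add_zero] at hsum
    have heq : ∀ x, f x * (Real.cos (ω * (x - a)) ^ (k + 1) * Real.cos (n * (ω * (x - a)))) =
        2⁻¹ * (f x * (Real.cos (ω * (x - a)) ^ k * Real.cos ((n + 1 : ℤ) * (ω * (x - a)))) +
          f x * (Real.cos (ω * (x - a)) ^ k * Real.cos ((n - 1 : ℤ) * (ω * (x - a))))) := by
      intro x
      push_cast
      rw [add_mul, sub_mul, one_mul, Real.cos_add, Real.cos_sub]
      ring
    simp_rw [heq]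
    rw [intervalIntegral.integral_const_mul, hsum, mul_zero]

/-- The map `x ↦ cos (π(x - a)/(b - a))` is a homeomorphism of `[a, b]` onto `[-1, 1]`, so by
Weierstrass `f` is a uniform limit of polynomials in this cosine. All of these are orthogonal to
`f`, which forces `∫ f² = 0`. -/
theorem eqOn_zero_of_cos_moments (hab : a < b) (hf : ContinuousOn f (Icc a b))
    (h : ∀ k : ℕ, ∫ x in a..b, f x * Real.cos (Real.pi / (b - a) * (x - a)) ^ k = 0) :
    ∀ x ∈ Icc a b, f x = 0 := by
  have hL : 0 < b - a := sub_pos.2 hab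
  have hpoly : ∀ P : Polynomial ℝ,
      ∫ x in a..b, f x * P.eval (Real.cos (Real.pi / (b - a) * (x - a))) = 0 := by
    intro P
    induction P using Polynomial.induction_on' with
    | add P Q hP hQ =>
      simp_rw [Polynomial.eval_add, mul_add]
      rw [intervalIntegral.integral_add, hP, hQ, add_zero] <;>
      exact (by fun_prop : ContinuousOn _ (Icc a b)).intervalIntegrable_of_Icc hab.le
    | monomial n c =>
      simp_rw [Polynomial.eval_monomial, mul_left_comm _ c]
      rw [intervalIntegral.integral_const_mul, h, mul_zero]
  by_contra! hne
  obtain ⟨x₀, hx₀, hfx₀⟩ := hne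
  have hI : 0 < ∫ x in a..b, f x * f x :=
    intervalIntegral.integral_pos hab (by fun_prop) (fun x _ => mul_self_nonneg _)
      ⟨x₀, hx₀, mul_self_pos.2 hfx₀⟩
  have hA : 0 ≤ ∫ x in a..b, |f x| :=
    intervalIntegral.integral_nonneg hab.le fun x _ => abs_nonneg _
  set I := ∫ x in a..b, f x * f x
  set A := ∫ x in a..b, |f x|
  -- With this precision `I ≤ I A / (A + 1)`, impossible for `I > 0`; the `+ 1` also avoids a
  -- separate case `A = 0`.
  have hε : 0 < I / (A + 1) := by positivity
  obtain ⟨P, hP⟩ := exists_polynomial_near_of_continuousOn (-1) 1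
    (fun y => f (a + (b - a) / Real.pi * Real.arccos y))
    (hf.comp (by fun_prop) fun y _ => by
      have h0 := Real.arccos_nonneg y
      have h1 : Real.arccos y / Real.pi ≤ 1 := (div_le_one Real.pi_pos).2 (Real.arccos_le_pi y)
      have h2 : 0 ≤ (b - a) / Real.pi * Real.arccos y := by positivity
      have h3 : (b - a) / Real.pi * Real.arccos y = (b - a) * (Real.arccos y / Real.pi) := by ring
      constructor
      · linarith
      · rw [h3]; nlinarith) _ hε
  have hclose : ∀ x ∈ Icc a b,
      |P.eval (Real.cos (Real.pi / (b - a) * (x - a))) - f x| ≤ I / (A + 1) := by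
    intro x hx
    have h1 := hP _ (Real.cos_mem_Icc (Real.pi / (b - a) * (x - a)))
    have h2 : 0 ≤ x - a := sub_nonneg.2 hx.1
    have h3 : Real.pi / (b - a) * (x - a) ≤ Real.pi := by
      rw [div_mul_eq_mul_div, div_le_iff₀ hL]
      exact mul_le_mul_of_nonneg_left (by linarith [hx.2]) Real.pi_pos.le
    rw [Real.arccos_cos (by positivity) h3] at h1
    have h4 : a + (b - a) / Real.pi * (Real.pi / (b - a) * (x - a)) = x := by
      field_simp
      ring
    rw [h4] at h1
    exact h1.le
  have hle : I ≤ I / (A + 1) * A := by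
    calc I = ∫ x in a..b,
          (f x * f x - f x * P.eval (Real.cos (Real.pi / (b - a) * (x - a)))) := by
          rw [intervalIntegral.integral_sub, hpoly, sub_zero] <;>
          exact (by fun_prop : ContinuousOn _ (Icc a b)).intervalIntegrable_of_Icc hab.le
      _ ≤ ∫ x in a..b, I / (A + 1) * |f x| := by
          refine intervalIntegral.integral_mono_on hab.le
            ((by fun_prop : ContinuousOn _ (Icc a b)).intervalIntegrable_of_Icc hab.le)
            ((by fun_prop : ContinuousOn _ (Icc a b)).intervalIntegrable_of_Icc hab.le)
            fun x hx => ?_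
          rw [← mul_sub]
          refine (le_abs_self _).trans ?_
          rw [abs_mul, abs_sub_comm, mul_comm]
          exact mul_le_mul_of_nonneg_right (hclose x hx) (abs_nonneg _)
      _ = I / (A + 1) * A := intervalIntegral.integral_const_mul _ _
  rw [div_mul_eq_mul_div, le_div_iff₀ (by positivity)] at hle
  linarith

theorem exists_integral_mul_cos_ne_zero (hab : a < b) (hf : ContinuousOn f (Icc a b))
    (hne : ¬ ∃ c : ℝ, ∀ x ∈ Icc a b, f x = c) :
    ∃ n : ℕ, n ≠ 0 ∧ ∫ x in a..b, f x * Real.cos (n * (Real.pi / (b - a)) * (x - a)) ≠ 0 := by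
  by_contra! H
  have hL : b - a ≠ 0 := (sub_pos.2 hab).ne'
  -- Subtracting the mean kills the zeroth coefficient and leaves the others unchanged.
  set m := (∫ x in a..b, f x) / (b - a) with hm
  refine hne ⟨m, fun x hx => sub_eq_zero.1
    (eqOn_zero_of_cos_moments (f := fun x => f x - m) hab (by fun_prop) (fun k => ?_) x hx)⟩
  have hall : ∀ n : ℤ, ∫ x in a..b,
      (f x - m) * Real.cos (n * (Real.pi / (b - a) * (x - a))) = 0 := by
    intro n
    have habs : ∀ x, Real.cos (n * (Real.pi / (b - a) * (x - a))) =
        Real.cos (n.natAbs * (Real.pi / (b - a)) * (x - a)) := by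
      intro x
      rw [Nat.cast_natAbs, Int.cast_abs, mul_assoc]
      rcases abs_choice (n : ℝ) with h | h <;> rw [h]
      rw [neg_mul, Real.cos_neg]
    simp_rw [habs, sub_mul]
    rw [intervalIntegral.integral_sub
      ((by fun_prop : ContinuousOn _ (Icc a b)).intervalIntegrable_of_Icc hab.le)
      ((by fun_prop : ContinuousOn _ (Icc a b)).intervalIntegrable_of_Icc hab.le),
      intervalIntegral.integral_const_mul]
    rcases eq_or_ne n.natAbs 0 with h0 | h0
    · simp [h0, hm, hL]
    · rw [H _ h0, integral_cos_mul_sub_eq_zero, mul_zero, sub_zero]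
      · have := Real.pi_pos.ne'
        positivity
      · rw [mul_assoc, div_mul_cancel₀ _ hL]
        exact Real.sin_nat_mul_pi _
  simpa using integral_mul_cos_pow_mul_cos_eq_zero hab.le (f := fun x => f x - m) (by fun_prop)
    hall k 0

end Cosine

/-! ### Space integrals depending on time -/

section Parametric

variable {a b T : ℝ} {f f' : ℝ → ℝ → ℝ}

theorem ContinuousOn.space_slice {S : Set ℝ}
    (hf : ContinuousOn (fun z : ℝ × ℝ => f z.1 z.2) (Icc a b ×ˢ S)) {t : ℝ} (ht : t ∈ S) :
    ContinuousOn (fun x => f x t) (Icc a b) :=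
  hf.comp (f := fun x => (x, t)) (by fun_prop) fun _ hx => ⟨hx, ht⟩

theorem continuousOn_integral_space (hab : a ≤ b) (hT : 0 ≤ T)
    (hf : ContinuousOn (fun z : ℝ × ℝ => f z.1 z.2) (Icc a b ×ˢ Icc 0 T)) :
    ContinuousOn (fun t => ∫ x in a..b, f x t) (Icc 0 T) := by
  -- Projecting both variables onto their intervals extends the integrand to a continuous function
  -- on the plane.
  have hc : Continuous (Function.uncurry fun (t x : ℝ) =>
      f (projIcc a b hab x) (projIcc 0 T hT t)) :=
    hf.comp_continuous (f := fun z : ℝ × ℝ =>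
      ((projIcc a b hab z.2 : ℝ), (projIcc 0 T hT z.1 : ℝ)))
      (by fun_prop) fun z => ⟨Subtype.coe_prop _, Subtype.coe_prop _⟩
  refine (intervalIntegral.continuous_parametric_intervalIntegral_of_continuous'
    (μ := MeasureTheory.volume) hc a b).continuousOn.congr fun t ht => ?_
  refine intervalIntegral.integral_congr fun x hx => ?_
  rw [uIcc_of_le hab] at hx
  simp [projIcc_of_mem hab hx, projIcc_of_mem hT ht]

theorem hasDerivAt_integral_space (hab : a ≤ b)
    (hf : ContinuousOn (fun z : ℝ × ℝ => f z.1 z.2) (Icc a b ×ˢ Ioo 0 T))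
    (hf' : ContinuousOn (fun z : ℝ × ℝ => f' z.1 z.2) (Icc a b ×ˢ Ioo 0 T))
    (h : ∀ x ∈ Icc a b, ∀ t ∈ Ioo 0 T, HasDerivAt (fun s => f x s) (f' x t) t)
    {t : ℝ} (ht : t ∈ Ioo 0 T) :
    HasDerivAt (fun s => ∫ x in a..b, f x s) (∫ x in a..b, f' x t) t := by
  obtain ⟨ht0, htT⟩ := ht
  -- The time derivative may be unbounded near `0` and `T`; a compact time neighbourhood of `t`
  -- supplies the dominating constant.
  have hK : Icc (t / 2) ((t + T) / 2) ⊆ Ioo 0 T := fun s hs =>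
    ⟨by linarith [hs.1], by linarith [hs.2]⟩
  obtain ⟨C, hC⟩ := (isCompact_Icc.prod isCompact_Icc).exists_bound_of_continuousOn
    (hf'.mono (prod_mono_right hK))
  have hmeas : ∀ g : ℝ → ℝ → ℝ,
      ContinuousOn (fun z : ℝ × ℝ => g z.1 z.2) (Icc a b ×ˢ Ioo 0 T) → ∀ s ∈ Ioo 0 T,
        IntervalIntegrable (fun x => g x s) MeasureTheory.volume a b := fun g hg s hs =>
    (hg.space_slice hs).intervalIntegrable_of_Icc hab
  have hmem : ∀ x ∈ uIoc a b, x ∈ Icc a b := fun x hx =>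
    Ioc_subset_Icc_self (uIoc_of_le hab ▸ hx)
  refine (intervalIntegral.hasDerivAt_integral_of_dominated_loc_of_deriv_le
    (F := fun s x => f x s) (F' := fun s x => f' x s) (bound := fun _ => C)
    (Icc_mem_nhds (a := t / 2) (b := (t + T) / 2) (by linarith) (by linarith)) ?_
    (hmeas f hf t ⟨ht0, htT⟩) (hmeas f' hf' t ⟨ht0, htT⟩).def'.aestronglyMeasurable ?_
    intervalIntegrable_const ?_).2
  · filter_upwards [Ioo_mem_nhds ht0 htT] with s hs
    exact (hmeas f hf s hs).def'.aestronglyMeasurable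
  · exact .of_forall fun x hx s hs => hC (x, s) ⟨hmem x hx, hs⟩
  · exact .of_forall fun x hx s hs => h x (hmem x hx) s (hK hs)

end Parametric

/-! ### The spatial problem -/

section Spatial

variable {d η δ ρ θ xa xb T : ℝ} {p₀ : ℝ → ℝ} {p u : ℝ → ℝ → ℝ}

theorem continuousOn_localTax (δ ρ T : ℝ) (hη : 0 < η) (hθ : θ ∈ Ioc (0 : ℝ) 1) :
    ContinuousOn (localTax η δ ρ θ T) (Icc 0 T) := by
  have hR := continuousOn_riccati (T := T) δ ρ hη hθ
  exact (hR.const_mul η).congr fun t _ => localTax_eq ..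

theorem IsLocalPair.spatialAdmissible {τ : ℝ → ℝ} (hx : xa < xb) (hτ : ContinuousOn τ (Icc 0 T))
    (h : IsLocalPair d η δ xa xb T τ p₀ p u) : SpatialAdmissible d η δ xa xb T p₀ p u := by
  refine ⟨?_, fun t ht => ?_, h.state⟩
  · refine ((hτ.comp continuousOn_snd fun z hz => hz.2).mul h.state.state_cont).congr
      fun z hz => h.control_eq _ hz.1 _ hz.2
  · have ht' := Ioc_subset_Icc_self ht
    obtain ⟨h1, h2⟩ := h.state.neumann t ht
    exact ⟨((h1.const_mul (τ t)).congr_deriv (mul_zero _)).congr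
        (fun x hx => h.control_eq x hx t ht') (h.control_eq _ (left_mem_Icc.2 hx.le) t ht'),
      ((h2.const_mul (τ t)).congr_deriv (mul_zero _)).congr
        (fun x hx => h.control_eq x hx t ht') (h.control_eq _ (right_mem_Icc.2 hx.le) t ht')⟩

/-! ### Evolution of the cosine coefficients of a local state -/

/-- The coefficient of `p` along `cos (ω (x - xa))` at time `t`. -/
noncomputable def cosCoeff (xa xb ω : ℝ) (p : ℝ → ℝ → ℝ) (t : ℝ) : ℝ :=
  ∫ x in xa..xb, p x t * Real.cos (ω * (x - xa))

theorem continuousOn_cosCoeff (hx : xa ≤ xb) (hT : 0 ≤ T) (ω : ℝ)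
    (hp : ContinuousOn (fun z : ℝ × ℝ => p z.1 z.2) (Icc xa xb ×ˢ Icc 0 T)) :
    ContinuousOn (cosCoeff xa xb ω p) (Icc 0 T) :=
  continuousOn_integral_space (f := fun x t => p x t * Real.cos (ω * (x - xa))) hx hT
    (by fun_prop)

/-- Integration by parts against an eigenfunction of the Neumann Laplacian. -/
theorem integral_second_deriv_mul_cos {f f' f'' : ℝ → ℝ} {a b ω : ℝ} (hab : a ≤ b)
    (hsin : Real.sin (ω * (b - a)) = 0) (hf'' : ContinuousOn f'' (Icc a b))
    (h1 : ∀ x ∈ Icc a b, HasDerivWithinAt f (f' x) (Icc a b) x)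
    (h2 : ∀ x ∈ Icc a b, HasDerivWithinAt f' (f'' x) (Icc a b) x)
    (ha : f' a = 0) (hb : f' b = 0) :
    ∫ x in a..b, f'' x * Real.cos (ω * (x - a)) =
      -ω ^ 2 * ∫ x in a..b, f x * Real.cos (ω * (x - a)) := by
  have hf : ContinuousOn f (Icc a b) := fun x hx => (h1 x hx).continuousWithinAt
  have hf' : ContinuousOn f' (Icc a b) := fun x hx => (h2 x hx).continuousWithinAt
  have hi : ∀ g : ℝ → ℝ, ContinuousOn g (Icc a b) →
      IntervalIntegrable (fun x => g x * Real.cos (ω * (x - a))) MeasureTheory.volume a b :=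
    fun g hg => (by fun_prop : ContinuousOn _ (Icc a b)).intervalIntegrable_of_Icc hab
  -- In the derivative of this primitive the terms `ω f' sin` cancel, and its boundary values vanish
  -- because `f'` and the sine do.
  have key := intervalIntegral.integral_eq_sub_of_hasDerivAt_of_le
    (f := fun x => f' x * Real.cos (ω * (x - a)) + ω * (f x * Real.sin (ω * (x - a)))) hab
    (by fun_prop) (fun x hx => by
      have hn := Icc_mem_nhds hx.1 hx.2
      have d0 := ((hasDerivAt_id x).sub_const a).const_mul ω
      have d1 := (h1 x (Ioo_subset_Icc_self hx)).hasDerivAt hn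
      have d2 := (h2 x (Ioo_subset_Icc_self hx)).hasDerivAt hn
      refine ((d2.mul d0.cos).add ((d1.mul d0.sin).const_mul ω)).congr_deriv
        (g' := f'' x * Real.cos (ω * (x - a)) + ω ^ 2 * (f x * Real.cos (ω * (x - a)))) ?_
      simp only [id]
      ring) ((hi _ hf'').add ((hi _ hf).const_mul _))
  rw [intervalIntegral.integral_add (hi _ hf'') ((hi _ hf).const_mul _),
    intervalIntegral.integral_const_mul, ha, hb, hsin] at key
  simp only [sub_self, mul_zero, Real.sin_zero, zero_mul, add_zero] at key
  linarith

/-- Because the tax depends on time only, the modes decouple; diffusion contributes the eigenvalue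
`-dω²`. -/
theorem IsLocalPair.hasDerivAt_cosCoeff {τ : ℝ → ℝ} {ω : ℝ} (hx : xa < xb)
    (hsin : Real.sin (ω * (xb - xa)) = 0)
    (h : IsLocalPair d η δ xa xb T τ p₀ p u) {t : ℝ} (ht : t ∈ Ioo 0 T) :
    HasDerivAt (cosCoeff xa xb ω p)
      ((η - δ - η * τ t - d * ω ^ 2) * cosCoeff xa xb ω p t) t := by
  obtain ⟨px, pxx, pt, -, hpxx, hpt, hder, hpde⟩ := h.state.state_eq
  have hp := h.state.state_cont.mono (prod_mono_right Ioo_subset_Icc_self)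
  have hmain := hasDerivAt_integral_space
    (f := fun x s => p x s * Real.cos (ω * (x - xa)))
    (f' := fun x s => pt x s * Real.cos (ω * (x - xa))) hx.le (by fun_prop) (by fun_prop)
    (fun x hx s hs => (hder x hx s hs).2.2.mul_const _) ht
  refine hmain.congr_deriv ?_
  have hN := h.state.neumann t (Ioo_subset_Ioc_self ht)
  have hl := left_mem_Icc.2 hx.le
  have hr := right_mem_Icc.2 hx.le
  have hparts := integral_second_deriv_mul_cos hx.le hsin (hpxx.space_slice ht)
    (fun x hx => (hder x hx t ht).1) (fun x hx => (hder x hx t ht).2.1)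
    ((uniqueDiffOn_Icc hx _ hl).eq_deriv _ (hder xa hl t ht).1 hN.1)
    ((uniqueDiffOn_Icc hx _ hr).eq_deriv _ (hder xb hr t ht).1 hN.2)
  have hps := hp.space_slice ht
  have hpxxs := hpxx.space_slice ht
  have hi : ∀ g : ℝ → ℝ, ContinuousOn g (Icc xa xb) →
      IntervalIntegrable (fun x => g x * Real.cos (ω * (x - xa))) MeasureTheory.volume xa xb :=
    fun g hg => (by fun_prop : ContinuousOn _ (Icc xa xb)).intervalIntegrable_of_Icc hx.le
  have hcongr : ∫ x in xa..xb, pt x t * Real.cos (ω * (x - xa)) =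
      ∫ x in xa..xb, (d * (pxx x t * Real.cos (ω * (x - xa))) +
        (η - δ - η * τ t) * (p x t * Real.cos (ω * (x - xa)))) := by
    -- The equation is only given at interior points, so the endpoints are dropped as a null set.
    rw [intervalIntegral.integral_of_le hx.le, intervalIntegral.integral_of_le hx.le,
      MeasureTheory.integral_Ioc_eq_integral_Ioo, MeasureTheory.integral_Ioc_eq_integral_Ioo]
    refine MeasureTheory.setIntegral_congr_fun measurableSet_Ioo fun x hxm => ?_
    simp only [hpde x hxm t ht,
      h.control_eq x (Ioo_subset_Icc_self hxm) t (Ioo_subset_Icc_self ht)]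
    ring
  rw [hcongr, intervalIntegral.integral_add ((hi _ hpxxs).const_mul _) ((hi _ hps).const_mul _),
    intervalIntegral.integral_const_mul, intervalIntegral.integral_const_mul, hparts, cosCoeff]
  ring

/-! ### Admissible cosine perturbations -/

/-- The amplitude of the control that generates the state `t cos (ω (x - xa))`. -/
noncomputable def controlAmp (d η δ ω t : ℝ) : ℝ :=
  ((η - δ - d * ω ^ 2) * t - 1) / η

theorem continuous_controlAmp (d η δ ω : ℝ) : Continuous (controlAmp d η δ ω) := by
  unfold controlAmp
  fun_prop

/-- The factor `t` preserves the initial distribution, the vanishing sine at both ends preserves the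
Neumann conditions, and `controlAmp` is obtained by solving the equation for the control. -/
theorem SpatialAdmissible.add_cos {ω : ℝ} (ε : ℝ) (hη : η ≠ 0)
    (hsin : Real.sin (ω * (xb - xa)) = 0) (h : SpatialAdmissible d η δ xa xb T p₀ p u) :
    SpatialAdmissible d η δ xa xb T p₀
      (fun x t => p x t + ε * t * Real.cos (ω * (x - xa)))
      (fun x t => u x t + ε * controlAmp d η δ ω t * Real.cos (ω * (x - xa))) := by
  have hψ := continuous_controlAmp d η δ ω
  have hcos : ∀ k x : ℝ, HasDerivAt (fun y => k * Real.cos (ω * (y - xa)))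
      (k * (-ω * Real.sin (ω * (x - xa)))) x := fun k x => by
    refine ((((hasDerivAt_id x).sub_const xa).const_mul ω).cos.const_mul k).congr_deriv ?_
    simp only [id]
    ring
  have hsin' : ∀ k x : ℝ, HasDerivAt (fun y => k * (-ω * Real.sin (ω * (y - xa))))
      (k * (-ω ^ 2 * Real.cos (ω * (x - xa)))) x := fun k x => by
    refine (((((hasDerivAt_id x).sub_const xa).const_mul ω).sin.const_mul (-ω)).const_mul
      k).congr_deriv ?_
    simp only [id]
    ring
  have hN : ∀ (f : ℝ → ℝ → ℝ) (k : ℝ → ℝ), Neumann xa xb T f →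
      Neumann xa xb T fun x t => f x t + k t * Real.cos (ω * (x - xa)) := fun f k hf t ht => by
    obtain ⟨h1, h2⟩ := hf t ht
    exact ⟨(h1.add (hcos (k t) xa).hasDerivWithinAt).congr_deriv (by simp),
      (h2.add (hcos (k t) xb).hasDerivWithinAt).congr_deriv (by simp [hsin])⟩
  obtain ⟨px, pxx, pt, hpx, hpxx, hpt, hder, hpde⟩ := h.state.state_eq
  have hp := h.state.state_cont
  have hu := h.control_cont
  refine ⟨by fun_prop, hN _ _ h.control_neumann, ⟨by fun_prop, ?_, hN p (fun t => ε * t)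
    h.state.neumann, fun x hx => by simp [h.state.initial x hx]⟩⟩
  refine ⟨fun x t => px x t + ε * t * (-ω * Real.sin (ω * (x - xa))),
    fun x t => pxx x t + ε * t * (-ω ^ 2 * Real.cos (ω * (x - xa))),
    fun x t => pt x t + ε * Real.cos (ω * (x - xa)),
    by fun_prop, by fun_prop, by fun_prop, fun x hx t ht => ?_, fun x hx t ht => ?_⟩
  · obtain ⟨h1, h2, h3⟩ := hder x hx t ht
    refine ⟨h1.add (hcos (ε * t) x).hasDerivWithinAt,
      h2.add (hsin' (ε * t) x).hasDerivWithinAt, h3.add ?_⟩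
    refine (((hasDerivAt_id t).const_mul ε).mul_const _).congr_deriv ?_
    simp
  · simp only [hpde x hx t ht, controlAmp]
    field_simp
    ring

/-! ### Expansion of the cost and its first variation -/

/-- The first variation of the cost at a local pair in the direction of the perturbation with
state `t cos (ω (x - xa))`. -/
noncomputable def firstVariation (d η δ ρ θ xa xb T ω : ℝ) (p : ℝ → ℝ → ℝ) : ℝ :=
  (∫ t in (0 : ℝ)..T, Real.exp (-ρ * t) *
      ((t + localTax η δ ρ θ T t * controlAmp d η δ ω t) * cosCoeff xa xb ω p t))
    + (1 - θ) / θ * (Real.exp (-ρ * T) * (T * cosCoeff xa xb ω p T))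

theorem integral_half_sq_add_cos {f : ℝ → ℝ} {a b : ℝ} (hab : a ≤ b)
    (hf : ContinuousOn f (Icc a b)) (ω k : ℝ) :
    ∫ x in a..b, (f x + k * Real.cos (ω * (x - a))) ^ 2 / 2 =
      (∫ x in a..b, f x ^ 2 / 2) + k * (∫ x in a..b, f x * Real.cos (ω * (x - a)))
        + k ^ 2 * ∫ x in a..b, Real.cos (ω * (x - a)) ^ 2 / 2 := by
  have h1 : IntervalIntegrable (fun x => f x ^ 2 / 2) MeasureTheory.volume a b :=
    (by fun_prop : ContinuousOn _ (Icc a b)).intervalIntegrable_of_Icc hab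
  have h2 : IntervalIntegrable (fun x => k * (f x * Real.cos (ω * (x - a))))
      MeasureTheory.volume a b :=
    (by fun_prop : ContinuousOn _ (Icc a b)).intervalIntegrable_of_Icc hab
  have h3 : IntervalIntegrable (fun x => k ^ 2 * (Real.cos (ω * (x - a)) ^ 2 / 2))
      MeasureTheory.volume a b :=
    (by fun_prop : Continuous _).intervalIntegrable _ _
  rw [← intervalIntegral.integral_const_mul, ← intervalIntegral.integral_const_mul,
    ← intervalIntegral.integral_add h1 h2, ← intervalIntegral.integral_add (h1.add h2) h3]
  exact intervalIntegral.integral_congr fun x _ => by ring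

theorem IsLocalPair.exists_spatialCost_add_cos (hη : 0 < η) (hθ : θ ∈ Ioc (0 : ℝ) 1)
    (hx : xa < xb) (hT : 0 < T) (h : IsLocalPair d η δ xa xb T (localTax η δ ρ θ T) p₀ p u)
    (ω : ℝ) :
    ∃ R : ℝ, ∀ ε : ℝ, spatialCost ρ θ xa xb T
      (fun x t => p x t + ε * t * Real.cos (ω * (x - xa)))
      (fun x t => u x t + ε * controlAmp d η δ ω t * Real.cos (ω * (x - xa))) =
      spatialCost ρ θ xa xb T p u + ε * firstVariation d η δ ρ θ xa xb T ω p + ε ^ 2 * R := by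
  have hτ := continuousOn_localTax δ ρ T hη hθ
  have hadm := h.spatialAdmissible hx hτ
  have hp := h.state.state_cont
  have hu := hadm.control_cont
  have hψ := continuous_controlAmp d η δ ω
  have hc := continuousOn_cosCoeff hx.le hT.le ω hp
  set M := ∫ x in xa..xb, Real.cos (ω * (x - xa)) ^ 2 / 2 with hM
  have hrun : ∀ ε : ℝ, ∀ t ∈ Icc 0 T, (∫ x in xa..xb,
      ((p x t + ε * t * Real.cos (ω * (x - xa))) ^ 2
        + (u x t + ε * controlAmp d η δ ω t * Real.cos (ω * (x - xa))) ^ 2) / 2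
          * Real.exp (-ρ * t)) =
      (∫ x in xa..xb, (p x t ^ 2 + u x t ^ 2) / 2 * Real.exp (-ρ * t))
        + ε * (Real.exp (-ρ * t) *
          ((t + localTax η δ ρ θ T t * controlAmp d η δ ω t) * cosCoeff xa xb ω p t))
        + ε ^ 2 * (Real.exp (-ρ * t) * ((t ^ 2 + controlAmp d η δ ω t ^ 2) * M)) := by
    intro ε t ht
    have hps := hp.space_slice ht
    have hus := hu.space_slice ht
    -- The feedback form of the control expresses both cross terms through the same cosine
    -- coefficient of the state.
    have hcu : ∫ x in xa..xb, u x t * Real.cos (ω * (x - xa)) =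
        localTax η δ ρ θ T t * cosCoeff xa xb ω p t := by
      rw [cosCoeff, ← intervalIntegral.integral_const_mul]
      refine intervalIntegral.integral_congr fun x hxm => ?_
      rw [uIcc_of_le hx.le] at hxm
      simp only [h.control_eq x hxm t ht]
      ring
    simp_rw [intervalIntegral.integral_mul_const, add_div]
    rw [intervalIntegral.integral_add
        ((by fun_prop : ContinuousOn _ (Icc xa xb)).intervalIntegrable_of_Icc hx.le)
        ((by fun_prop : ContinuousOn _ (Icc xa xb)).intervalIntegrable_of_Icc hx.le),
      intervalIntegral.integral_add
        ((by fun_prop : ContinuousOn _ (Icc xa xb)).intervalIntegrable_of_Icc hx.le)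
        ((by fun_prop : ContinuousOn _ (Icc xa xb)).intervalIntegrable_of_Icc hx.le),
      integral_half_sq_add_cos hx.le hps, integral_half_sq_add_cos hx.le hus, hcu, ← hM, cosCoeff]
    ring
  have hterm : ∀ ε : ℝ, (∫ x in xa..xb,
      (p x T + ε * T * Real.cos (ω * (x - xa))) ^ 2 / 2 * Real.exp (-ρ * T)) =
      (∫ x in xa..xb, p x T ^ 2 / 2 * Real.exp (-ρ * T))
        + ε * (Real.exp (-ρ * T) * (T * cosCoeff xa xb ω p T))
        + ε ^ 2 * (Real.exp (-ρ * T) * (T ^ 2 * M)) := by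
    intro ε
    simp_rw [intervalIntegral.integral_mul_const]
    rw [integral_half_sq_add_cos hx.le (hp.space_slice (right_mem_Icc.2 hT.le)), ← hM, cosCoeff]
    ring
  have hi0 : IntervalIntegrable
      (fun t => ∫ x in xa..xb, (p x t ^ 2 + u x t ^ 2) / 2 * Real.exp (-ρ * t))
      MeasureTheory.volume 0 T :=
    (continuousOn_integral_space (f := fun x t => (p x t ^ 2 + u x t ^ 2) / 2 * Real.exp (-ρ * t))
      hx.le hT.le (by fun_prop)).intervalIntegrable_of_Icc hT.le
  have hi1 : IntervalIntegrable (fun t => Real.exp (-ρ * t) *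
      ((t + localTax η δ ρ θ T t * controlAmp d η δ ω t) * cosCoeff xa xb ω p t))
      MeasureTheory.volume 0 T :=
    (by fun_prop : ContinuousOn _ (Icc 0 T)).intervalIntegrable_of_Icc hT.le
  have hi2 : IntervalIntegrable (fun t => Real.exp (-ρ * t) *
      ((t ^ 2 + controlAmp d η δ ω t ^ 2) * M)) MeasureTheory.volume 0 T :=
    (by fun_prop : Continuous _).intervalIntegrable _ _
  refine ⟨(∫ t in (0 : ℝ)..T, Real.exp (-ρ * t) * ((t ^ 2 + controlAmp d η δ ω t ^ 2) * M))
    + (1 - θ) / θ * (Real.exp (-ρ * T) * (T ^ 2 * M)), fun ε => ?_⟩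
  rw [spatialCost, hterm, intervalIntegral.integral_congr
    (fun t ht => hrun ε t (by rwa [uIcc_of_le hT.le] at ht)),
    intervalIntegral.integral_add (hi0.add (hi1.const_mul ε)) (hi2.const_mul _),
    intervalIntegral.integral_add hi0 (hi1.const_mul ε),
    intervalIntegral.integral_const_mul, intervalIntegral.integral_const_mul, spatialCost,
    firstVariation]
  ring

/-- Integrate the derivative of `R t e^{-ρt} c`: it vanishes at `0` and gives the terminal term at
`T`. All terms cancel against the running part except diffusion, which enters twice, through the
decay of `c` and through `controlAmp`; hence the factor `2`. -/
theorem IsLocalPair.firstVariation_eq {ω : ℝ} (hη : 0 < η) (hθ : θ ∈ Ioc (0 : ℝ) 1)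
    (hx : xa < xb) (hT : 0 < T) (hsin : Real.sin (ω * (xb - xa)) = 0)
    (h : IsLocalPair d η δ xa xb T (localTax η δ ρ θ T) p₀ p u) :
    firstVariation d η δ ρ θ xa xb T ω p = -2 * d * ω ^ 2 *
      ∫ t in (0 : ℝ)..T, riccati η δ ρ θ T t * t * Real.exp (-ρ * t) * cosCoeff xa xb ω p t := by
  have hτ := continuousOn_localTax δ ρ T hη hθ
  have hR := continuousOn_riccati (T := T) δ ρ hη hθ
  have hψ := continuous_controlAmp d η δ ω
  have hc := continuousOn_cosCoeff hx.le hT.le ω h.state.state_cont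
  have hi1 : IntervalIntegrable (fun t => Real.exp (-ρ * t) *
      ((t + localTax η δ ρ θ T t * controlAmp d η δ ω t) * cosCoeff xa xb ω p t))
      MeasureTheory.volume 0 T :=
    (by fun_prop : ContinuousOn _ (Icc 0 T)).intervalIntegrable_of_Icc hT.le
  have hi2 : IntervalIntegrable (fun t => -2 * d * ω ^ 2 *
      (riccati η δ ρ θ T t * t * Real.exp (-ρ * t) * cosCoeff xa xb ω p t))
      MeasureTheory.volume 0 T :=
    (by fun_prop : ContinuousOn _ (Icc 0 T)).intervalIntegrable_of_Icc hT.le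
  have key := intervalIntegral.integral_eq_sub_of_hasDerivAt_of_le
    (f := fun t => riccati η δ ρ θ T t * t * Real.exp (-ρ * t) * cosCoeff xa xb ω p t) hT.le
    (by fun_prop) (fun t ht => by
      have h1 := hasDerivAt_riccati δ ρ hη hθ ht.2.le
      have h2 := h.hasDerivAt_cosCoeff hx hsin ht
      have h3 := ((hasDerivAt_id t).const_mul (-ρ)).exp
      refine (((h1.mul (hasDerivAt_id t)).mul h3).mul h2).congr_deriv
        (g' := -2 * d * ω ^ 2 *
          (riccati η δ ρ θ T t * t * Real.exp (-ρ * t) * cosCoeff xa xb ω p t) -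
          Real.exp (-ρ * t) *
            ((t + localTax η δ ρ θ T t * controlAmp d η δ ω t) * cosCoeff xa xb ω p t)) ?_
      simp only [localTax_eq, controlAmp, id, Pi.mul_apply]
      field_simp
      ring) (hi2.sub hi1)
  rw [intervalIntegral.integral_sub hi2 hi1, intervalIntegral.integral_const_mul,
    riccati_terminal δ ρ hη] at key
  rw [firstVariation]
  linear_combination -key

theorem IsLocalPair.firstVariation_ne_zero {ω : ℝ} (hd : 0 < d) (hη : 0 < η)
    (hθ : θ ∈ Ioc (0 : ℝ) 1) (hx : xa < xb) (hT : 0 < T) (hω : ω ≠ 0)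
    (hsin : Real.sin (ω * (xb - xa)) = 0)
    (h : IsLocalPair d η δ xa xb T (localTax η δ ρ θ T) p₀ p u)
    (h0 : cosCoeff xa xb ω p 0 ≠ 0) :
    firstVariation d η δ ρ θ xa xb T ω p ≠ 0 := by
  set κ := d * ω ^ 2
  have hR := continuousOn_riccati (T := T) δ ρ hη hθ
  have hE : ContinuousOn (closedLoop η δ ρ θ T κ) (Icc 0 T) := fun t ht =>
    (hasDerivAt_closedLoop δ ρ κ hη hθ ht.2).continuousAt.continuousWithinAt
  have hc : ∀ t ∈ Icc 0 T, cosCoeff xa xb ω p t =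
      cosCoeff xa xb ω p 0 / closedLoop η δ ρ θ T κ 0 * closedLoop η δ ρ θ T κ t := fun t ht =>
    eq_mul_of_linear_ode (continuousOn_cosCoeff hx.le hT.le ω h.state.state_cont) hE
      (fun s hs => (closedLoop_pos δ ρ κ hη hθ hs.2).ne')
      (fun s hs => h.hasDerivAt_cosCoeff hx hsin hs)
      (fun s hs => hasDerivAt_closedLoop δ ρ κ hη hθ hs.2.le) ht
  -- Every factor is positive on the open interval; `R` may vanish at `T`, when `θ = 1`.
  have hpos : 0 < ∫ t in (0 : ℝ)..T,
      riccati η δ ρ θ T t * t * Real.exp (-ρ * t) * closedLoop η δ ρ θ T κ t :=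
    intervalIntegral.intervalIntegral_pos_of_pos_on
      ((by fun_prop : ContinuousOn _ (Icc 0 T)).intervalIntegrable_of_Icc hT.le)
      (fun t ht => mul_pos (mul_pos (mul_pos (riccati_pos δ ρ hη hθ ht.2) ht.1)
        (Real.exp_pos _)) (closedLoop_pos δ ρ κ hη hθ ht.2.le)) hT
  rw [h.firstVariation_eq hη hθ hx hT hsin, intervalIntegral.integral_congr
    (g := fun t => cosCoeff xa xb ω p 0 / closedLoop η δ ρ θ T κ 0 *
      (riccati η δ ρ θ T t * t * Real.exp (-ρ * t) * closedLoop η δ ρ θ T κ t))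
    (fun t ht => by
      rw [uIcc_of_le hT.le] at ht
      simp only [hc t ht]
      ring), intervalIntegral.integral_const_mul]
  have hE0 := (closedLoop_pos δ ρ κ hη hθ hT.le).ne'
  have hd' := hd.ne'
  have hpos' := hpos.ne'
  positivity

end Spatial

/-! ### Conclusion from the stationarity condition -/

theorem eq_zero_of_forall_mul_add_sq_mul_nonneg {D R : ℝ}
    (h : ∀ ε : ℝ, 0 ≤ ε * D + ε ^ 2 * R) : D = 0 := by
  by_contra hD
  have hK : 0 < |R| + 1 := by positivity
  -- A step against the slope, short enough for the linear term to dominate: the value is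
  -- `(D/(|R|+1))² (R - |R| - 1) < 0`.
  have h1 := h (-D / (|R| + 1))
  have h2 : -D / (|R| + 1) * D + (-D / (|R| + 1)) ^ 2 * R =
      (D / (|R| + 1)) ^ 2 * (R - (|R| + 1)) := by
    field_simp
    ring
  have h3 : 0 < (D / (|R| + 1)) ^ 2 := by positivity
  nlinarith [le_abs_self R]


theorem proposition2 (d η δ ρ θ xa xb T : ℝ)
    (hd : 0 < d) (hη : 0 < η) (hδ : 0 < δ) (hρ : 0 < ρ) (hθ : θ ∈ Set.Ioc (0 : ℝ) 1)
    (hx : xa < xb) (hT : 0 < T)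
    (p₀ : ℝ → ℝ) (hp₀ : ContinuousOn p₀ (Set.Icc xa xb))
    (hpos : ∀ x ∈ Set.Icc xa xb, 0 < p₀ x)
    (hhet : ¬ ∃ c : ℝ, ∀ x ∈ Set.Icc xa xb, p₀ x = c) :
    IsAspatialOptimalTax η δ ρ θ T (localTax η δ ρ θ T) ∧
    ∀ pbar ubar : ℝ → ℝ → ℝ,
      IsLocalPair d η δ xa xb T (localTax η δ ρ θ T) p₀ pbar ubar →
        SpatialAdmissible d η δ xa xb T p₀ pbar ubar ∧
        ¬ SpatialOptimal d η δ ρ θ xa xb T p₀ pbar ubar := by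
  refine ⟨isAspatialOptimalTax_localTax hη hθ hT, fun pbar ubar h => ?_⟩
  have hadm := h.spatialAdmissible hx (continuousOn_localTax δ ρ T hη hθ)
  refine ⟨hadm, fun hopt => ?_⟩
  obtain ⟨n, hn, hcoeff⟩ := exists_integral_mul_cos_ne_zero hx hp₀ hhet
  have hL : xb - xa ≠ 0 := (sub_pos.2 hx).ne'
  set ω := n * (Real.pi / (xb - xa)) with hω
  have hω0 : ω ≠ 0 := by
    have := Real.pi_pos.ne'
    positivity
  have hsin : Real.sin (ω * (xb - xa)) = 0 := by
    rw [hω, mul_assoc, div_mul_cancel₀ _ hL]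
    exact Real.sin_nat_mul_pi n
  have h0 : cosCoeff xa xb ω pbar 0 ≠ 0 := by
    convert hcoeff using 1
    refine intervalIntegral.integral_congr fun x hxm => ?_
    rw [uIcc_of_le hx.le] at hxm
    simp only [h.state.initial x hxm]
  obtain ⟨R, hR⟩ := h.exists_spatialCost_add_cos hη hθ hx hT ω
  refine h.firstVariation_ne_zero hd hη hθ hx hT hω0 hsin h0
    (eq_zero_of_forall_mul_add_sq_mul_nonneg (R := R) fun ε => ?_)
  have hle := hopt.2 _ _ (hadm.add_cos ε hη.ne' hsin)
  rw [hR] at hle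
  linarith
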